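/- Conventions. A class of hypotheses is a set $\mathcal H$ of functions $h:\mathbb N\to\{0,1\}$. A sample is a finite sequence of pairs in $\mathbb N\times\{0,1\}$. A learner is a partial function $L$ that maps a sample $S$ and an element $x\in\mathbb N$ to a prediction $L(S,x)\in\{0,1\}$. A sequence $(x_t,y_t)_{t\ge 0}$ in $\mathbb N\times\{0,1\}$ is $\mathcal H$-realizable if for every $T$ there is $h\in\mathcal H$ with $h(x_t)=y_t$ for all $t\le T$. Let $\varphi_0,\varphi_1,\dots$ be the standard numbering of the partial computable functions; through a fixed computable coding of inputs and outputs, $\varphi_n$ is also read as a partial function from samples and elements to labels, or from $\mathbb N$ to labels (undefined where its output is not a label). * $\mathcal H$ is computably universally online learnable if there is a partial computable learner $L$ such that, for every $\mathcal H$-realizable sequence $(x_t,y_t)_{t\ge 0}$, the prediction $L((x_i,y_i)_{i<t},x_t)$ is defined for every $t$ and equals $y_t$ for all but finitely many $t$. * A randomized computable learner is a learner $L$ computed by a single program with access to an infinite sequence of independent fair random bits; it is almost total if, with probability one over these bits, it halts on every input. $\mathcal H$ is computably agnostically learnable if there is an almost total randomized computable learner $L$ such that, for every sequence $(x_t,y_t)_{t\ge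 0}$ in $\mathbb N\times\{0,1\}$, the expected regret $$R_n=\mathbb E\Big(\sum_{0<t\le n}\mathbf 1\big[L((x_i,y_i)_{i=0}^{t-1},x_t)\ne y_t\big]-\min_{h\in\mathcal H}\sum_{0<t\le n}\mathbf 1\big[h(x_t)\ne y_t\big]\Big)$$ is at most sublinear, i.e. for every $\varepsilon>0$, $R_n\le\varepsilon n$ for all sufficiently large $n$; the expectation is over the random bits. * $\mathcal H$ is RER (recursively enumerably representable) if $\mathcal H=\{\varphi_e:e\in E\}$ for some computably enumerable set $E\subseteq\mathbb N$. * The closure $\overline{\mathcal H}$ is the set of all $g:\mathbb N\to\{0,1\}$ for which there are $h_0,h_1,\dots\in\mathcal H$ and $n_0<n_1<\cdots$ such that $h_i(x)=g(x)$ for all $i$ and all $x<n_i$. * An infinite binary sequence $h$ is an evil sequence for $\varphi_n$ if it starts with $0^n1$ and, for every $k>n$, $\varphi_n\big((i,h(i))_{i=0}^{k-1},k\big)=1-h(k)$. Theorem. There is a class $\mathcal H$ of total computable functions that is computably universally online learnable but not computably agnostically learnable. Moreover, one such class is the class $\mathcal H$ of the evil sequences for all those $\varphi_n$ that are total learners;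 this $\mathcal H$ is not RER, and its closure is $\mathcal H\cup\{0^\infty\}$. -/

import Mathlib

open MeasureTheory Filter

/-- A finite sequence of labelled examples, oldest example first. -/
abbrev Sample : Type := List (ℕ × Bool)

/-- The sample `(x_t, y_t)`, `0 ≤ t < n`. -/
def sample (x : ℕ → ℕ) (y : ℕ → Bool) (n : ℕ) : Sample :=
  (List.range n).map fun t => (x t, y t)

/-- A learner: a partial function which, given a sample and an element, predicts a label. -/
abbrev Learner : Type := Sample × ℕ →. Bool

/-- An infinite sequence `(x_t, y_t)` is realizable by `H` if each of its finite initial segments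
is consistent with some member of `H` (which may depend on the segment). -/
def Realizable (H : Set (ℕ → Bool)) (x : ℕ → ℕ) (y : ℕ → Bool) : Prop :=
  ∀ T : ℕ, ∃ h ∈ H, ∀ t ≤ T, h (x t) = y t

/-- `L` universally online learns `H`: on every realizable sequence `L` makes a prediction in each
round, and all predictions from some round on are correct. -/
def UniversallyOnlineLearns (L : Learner) (H : Set (ℕ → Bool)) : Prop :=
  ∀ (x : ℕ → ℕ) (y : ℕ → Bool), Realizable H x y →
    (∀ n, (L (sample x y n, x n)).Dom) ∧
    ∃ m, ∀ n > m, y (n + 1) ∈ L (sample x y (n + 1), x (n + 1))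

/-- `H` is computably universally online learnable. -/
def ComputablyUniversallyOnlineLearnable (H : Set (ℕ → Bool)) : Prop :=
  ∃ L : Learner, Partrec L ∧ UniversallyOnlineLearns L H

/-- The functionals `(r, n) ↦ F r n` computed by programs that have access to an infinite source
`r` of bits: the partial recursive functions, with the bits of `r` as an additional basic
function. The program does not depend on `r`. -/
inductive BitPartrec : ((ℕ → Bool) → ℕ →. ℕ) → Prop
  | zero : BitPartrec fun _ _ => Part.some 0
  | succ : BitPartrec fun _ n => Part.some (n + 1)
  | left : BitPartrec fun _ n => Part.some n.unpair.1
  | right : BitPartrec fun _ n => Part.some n.unpair.2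
  | bit : BitPartrec fun r n => Part.some (r n).toNat
  | pair {F G} : BitPartrec F → BitPartrec G →
      BitPartrec fun r n => Nat.pair <$> F r n <*> G r n
  | comp {F G} : BitPartrec F → BitPartrec G →
      BitPartrec fun r n => G r n >>= F r
  | prec {F G} : BitPartrec F → BitPartrec G →
      BitPartrec fun r => Nat.unpaired fun a n =>
        n.rec (F r a) fun y IH => do
          let i ← IH
          G r (Nat.pair a (Nat.pair y i))
  | rfind {F} : BitPartrec F →
      BitPartrec fun r a => Nat.rfind fun n => (fun m => m = 0) <$> F r (Nat.pair a n)

/-- A randomized learner: a learner for each value of the internal randomness. -/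
abbrev RandomizedLearner : Type := (ℕ → Bool) → Learner

/-- The randomized learner is computed by a program with access to the random bits. -/
def RandomizedLearner.IsComputable (L : RandomizedLearner) : Prop :=
  BitPartrec fun r n =>
    Part.bind (Encodable.decode (α := Sample × ℕ) n : Part (Sample × ℕ)) fun p =>
      (L r p).map Encodable.encode

/-- The law of an infinite sequence of independent fair random bits. -/
noncomputable def fairBits : Measure (ℕ → Bool) :=
  Measure.infinitePi fun _ : ℕ => (PMF.uniformOfFintype Bool).toMeasure

/-- With probability one over the internal randomness, the learner is defined on all inputs. -/
def RandomizedLearner.AlmostTotal (L : RandomizedLearner) : Prop :=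
  ∀ᵐ r ∂fairBits, ∀ p, (L r p).Dom

/-- The number of rounds `0 < t ≤ n` in which the learner `L` does not predict the label `y_t`
when it has seen the first `t` examples. -/
noncomputable def Learner.mistakes (L : Learner) (x : ℕ → ℕ) (y : ℕ → Bool) (n : ℕ) : ℕ :=
  {t : ℕ | 0 < t ∧ t ≤ n ∧ y t ∉ L (sample x y t, x t)}.ncard

/-- The number of rounds `0 < t ≤ n` in which the hypothesis `h` does not give the label `y_t`. -/
noncomputable def hypothesisMistakes (h : ℕ → Bool) (x : ℕ → ℕ) (y : ℕ → Bool) (n : ℕ) : ℕ :=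
  {t : ℕ | 0 < t ∧ t ≤ n ∧ h (x t) ≠ y t}.ncard

/-- The number of mistakes, in the rounds `0 < t ≤ n`, of the best hypothesis of `H`. -/
noncomputable def bestMistakes (H : Set (ℕ → Bool)) (x : ℕ → ℕ) (y : ℕ → Bool) (n : ℕ) : ℕ :=
  sInf ((fun h => hypothesisMistakes h x y n) '' H)

/-- The expected regret of a randomized learner with respect to `H` after `n` rounds. -/
noncomputable def expectedRegret (L : RandomizedLearner) (H : Set (ℕ → Bool))
    (x : ℕ → ℕ) (y : ℕ → Bool) (n : ℕ) : ℝ :=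
  ∫ r, (((L r).mistakes x y n : ℝ) - (bestMistakes H x y n : ℝ)) ∂fairBits

/-- On every sequence, realizable or not, the expected regret is at most sublinear. -/
def AgnosticallyLearns (L : RandomizedLearner) (H : Set (ℕ → Bool)) : Prop :=
  ∀ (x : ℕ → ℕ) (y : ℕ → Bool), ∀ ε > (0 : ℝ),
    ∀ᶠ n : ℕ in atTop, expectedRegret L H x y n ≤ ε * n

/-- `H` is computably agnostically (universally online) learnable. -/
def ComputablyAgnosticallyLearnable (H : Set (ℕ → Bool)) : Prop :=
  ∃ L : RandomizedLearner, L.IsComputable ∧ L.AlmostTotal ∧ AgnosticallyLearns L H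

/-- The partial function from `α` to `β` computed by the `n`-th program, inputs and outputs being
coded by natural numbers; it is undefined where the output is not the code of an element
of `β`. -/
def program (α β : Type) [Primcodable α] [Primcodable β] (n : ℕ) : α →. β := fun a =>
  (Nat.Partrec.Code.eval (Denumerable.ofNat Nat.Partrec.Code n) (Encodable.encode a)).bind
    fun k => (Encodable.decode (α := β) k : Part β)

/-- `H = {φ_e : e ∈ E}` for some computably enumerable set `E` of indices of programs. -/
def RER (H : Set (ℕ → Bool)) : Prop :=
  ∃ E : ℕ → Prop, REPred E ∧
    (∀ e, E e → ∃ h ∈ H, program ℕ Bool e = (h : ℕ →. Bool)) ∧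
    (∀ h ∈ H, ∃ e, E e ∧ program ℕ Bool e = (h : ℕ →. Bool))

/-- The closure of a class of hypotheses. -/
def classClosure (H : Set (ℕ → Bool)) : Set (ℕ → Bool) :=
  {g | ∃ (h : ℕ → ℕ → Bool) (n : ℕ → ℕ), (∀ i, h i ∈ H) ∧ StrictMono n ∧
    ∀ i, ∀ x < n i, h i x = g x}

/-- `h` starts with `0^n 1`, and from then on the `n`-th program, as a learner that is shown the
values of `h` one by one, predicts each of them incorrectly. -/
def IsEvilSequence (n : ℕ) (h : ℕ → Bool) : Prop :=
  (∀ i < n, h i = false) ∧ h n = true ∧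
    ∀ k > n, (!h k) ∈ program (Sample × ℕ) Bool n (sample id h k, k)

/-- The class of the evil sequences for all total computable learners. -/
def evilClass : Set (ℕ → Bool) :=
  {h | ∃ n, (∀ p, (program (Sample × ℕ) Bool n p).Dom) ∧ IsEvilSequence n h}

/-! An evil sequence is determined by its index: after `0^n 1`, each label negates the prediction of
`φ_n`. A total `φ_n` has exactly one, a partial `φ_n` at most one, and every evil sequence is
computable.

Online learnability: predict `0` until some element `x` has had label `1`. Since evil sequences of
index `n` start with `0^n`, only indices `n ≤ x` remain possible. Totality of `φ_n` is undecidable,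
but finite prefixes suffice: search for an index and a computed prefix that fits the sample and
reaches the queried element. On a realizable sequence the search halts, and an index that causes an
error fits no later sample, so at most `x + 1` errors occur after the first `1`
(`evilLearner_learns`).

Agnostic learning fails because randomness can be removed. From an almost total randomized learner
`L`, `RandomizedLearner.exists_derandomization` builds a total computable `D` that only predicts
labels which `L` predicts with probability at least `1/4`. Along the evil sequence of `D`, a member
of the class, `L` errs with probability at least `1/4` in every late round, whereas the best
hypothesis never errs: the regret is linear.

Were the class enumerable, a total learner could copy on suitable elements the functions enumerated
so far; its own evil sequence would be among them, hence predicted correctly somewhere. In the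
closure, a limit with first `1` at `m` comes from sequences of index `m`, all equal; `0^∞` is a
limit because total learners have arbitrarily large indices. -/

open Nat.Partrec (Code)

/-! ### Evil sequences as deterministic recursions -/

/-- The first `k` values of `h`. -/
def labels (h : ℕ → Bool) (k : ℕ) : List Bool :=
  (List.range k).map h

@[simp] theorem length_labels (h : ℕ → Bool) (k : ℕ) : (labels h k).length = k := by
  simp [labels]

theorem labels_succ (h : ℕ → Bool) (k : ℕ) : labels h (k + 1) = labels h k ++ [h k] := by
  simp [labels, List.range_succ]

theorem getElem?_labels (h : ℕ → Bool) {i k : ℕ} (hi : i < k) :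
    (labels h k)[i]? = some (h i) := by
  simp [labels, hi]

theorem take_labels (h : ℕ → Bool) {i k : ℕ} (hi : i ≤ k) :
    (labels h k).take i = labels h i := by
  simp [labels, ← List.map_take, List.take_range, hi]

theorem labels_prefix (h : ℕ → Bool) {i k : ℕ} (hi : i ≤ k) : labels h i <+: labels h k := by
  rw [← take_labels h hi]
  exact List.take_prefix _ _

/-- Every rule that determines the next label from the earlier ones generates a sequence. -/
theorem exists_forall_eq_labels (step : List Bool → Bool) :
    ∃ h : ℕ → Bool, ∀ k, h k = step (labels h k) := by
  let l : ℕ → List Bool := fun k => Nat.rec [] (fun _ l => l ++ [step l]) k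
  have hl : ∀ k, l (k + 1) = l k ++ [step (l k)] := fun _ => rfl
  have key : ∀ k, labels (fun k => step (l k)) k = l k := by
    intro k
    induction k with
    | zero => rfl
    | succ k ih => rw [labels_succ, ih, hl]
  exact ⟨fun k => step (l k), fun k => by rw [key]⟩

/-- The sample `(0, b₀), (1, b₁), …` for a list of labels `b₀, b₁, …`. -/
def labelSample (l : List Bool) : Sample :=
  (List.range l.length).map fun t => (t, l.getD t false)

theorem labelSample_labels (h : ℕ → Bool) (k : ℕ) : labelSample (labels h k) = sample id h k := by
  simp only [labelSample, sample, length_labels]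
  refine List.map_congr_left fun t ht => ?_
  simp [List.getD_eq_getElem?_getD, getElem?_labels h (List.mem_range.1 ht)]

theorem primrec_labelSample : Primrec labelSample :=
  Primrec.list_map (Primrec.list_range.comp Primrec.list_length)
    (Primrec.snd.pair ((Primrec.list_getD false).comp Primrec.fst Primrec.snd)).to₂

/-- The label that follows the labels `l` in an evil sequence for the `n`-th program. -/
def evilStep (n : ℕ) (l : List Bool) : Part Bool :=
  if l.length < n then Part.some false
  else if l.length = n then Part.some true
  else (program (Sample × ℕ) Bool n (labelSample l, l.length)).map (!·)

/-- The three clauses merge into one single-valued recursion, from which existence, uniqueness and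
computability follow. -/
theorem isEvilSequence_iff {n : ℕ} {h : ℕ → Bool} :
    IsEvilSequence n h ↔ ∀ k, h k ∈ evilStep n (labels h k) := by
  constructor
  · rintro ⟨h0, h1, h2⟩ k
    simp only [evilStep, length_labels, labelSample_labels]
    split_ifs with hk hk'
    · simp [h0 k hk]
    · simp [hk', h1]
    · exact Part.mem_map_iff _ |>.2 ⟨_, h2 k (by omega), by simp⟩
  · intro H
    simp only [evilStep, length_labels, labelSample_labels] at H
    refine ⟨fun i hi => by simpa [hi] using H i, by simpa using H n, fun k hk => ?_⟩
    have := H k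
    rw [if_neg (by omega), if_neg (by omega)] at this
    obtain ⟨b, hb, hb'⟩ := (Part.mem_map_iff _).1 this
    simpa [← hb'] using hb

theorem exists_isEvilSequence {n : ℕ} (hn : ∀ p, (program (Sample × ℕ) Bool n p).Dom) :
    ∃ h, IsEvilSequence n h := by
  have hd : ∀ l, (evilStep n l).Dom := by
    intro l
    unfold evilStep
    split_ifs
    · trivial
    · trivial
    · exact hn _
  obtain ⟨h, hh⟩ := exists_forall_eq_labels fun l => (evilStep n l).get (hd l)
  exact ⟨h, isEvilSequence_iff.2 fun k => hh k ▸ Part.get_mem _⟩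

/-- `l` is an initial segment of an evil sequence for the `n`-th program, as far as can be seen. -/
def IsEvilPrefix (n : ℕ) (l : List Bool) : Prop :=
  ∀ i, ∀ b ∈ l[i]?, b ∈ evilStep n (l.take i)

theorem IsEvilSequence.isEvilPrefix_labels {n : ℕ} {h : ℕ → Bool} (H : IsEvilSequence n h)
    (k : ℕ) : IsEvilPrefix n (labels h k) := by
  intro i b hb
  have hi : i < k := by
    by_contra hi
    rw [Option.mem_def, List.getElem?_eq_none (by simpa using hi)] at hb
    cases hb
  rw [getElem?_labels h hi, Option.mem_some_iff] at hb
  rw [take_labels h hi.le, ← hb]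
  exact isEvilSequence_iff.1 H i

/-- The next label is a single-valued function of the earlier ones. Totality of the program plays no
role, so this also covers the spurious candidates met by the online learner. -/
theorem IsEvilPrefix.take_eq {n : ℕ} {l l' : List Bool} (hl : IsEvilPrefix n l)
    (hl' : IsEvilPrefix n l') (i : ℕ) (hi : i ≤ l.length) (hi' : i ≤ l'.length) :
    l.take i = l'.take i := by
  induction i with
  | zero => simp
  | succ i ih =>
    have ih := ih (by omega) (by omega)
    have h1 := hl i l[i] (by simp)
    have h2 := hl' i l'[i] (by simp)
    rw [ih] at h1
    rw [List.take_succ_eq_append_getElem (by omega), List.take_succ_eq_append_getElem (by omega),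
      ih, Part.mem_unique h1 h2]

theorem IsEvilPrefix.getElem?_unique {n : ℕ} {l l' : List Bool} (hl : IsEvilPrefix n l)
    (hl' : IsEvilPrefix n l') {i : ℕ} {b b' : Bool} (hb : l[i]? = some b)
    (hb' : l'[i]? = some b') : b = b' := by
  have hi := (List.getElem?_eq_some_iff.1 hb).1
  have hi' := (List.getElem?_eq_some_iff.1 hb').1
  have h1 := hl i b hb
  rw [hl.take_eq hl' i hi.le hi'.le] at h1
  exact Part.mem_unique h1 (hl' i b' hb')

theorem IsEvilSequence.unique {n : ℕ} {h h' : ℕ → Bool} (H : IsEvilSequence n h)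
    (H' : IsEvilSequence n h') : h = h' := by
  funext i
  exact (H.isEvilPrefix_labels (i + 1)).getElem?_unique (H'.isEvilPrefix_labels (i + 1))
    (getElem?_labels h i.lt_succ_self) (getElem?_labels h' i.lt_succ_self)

/-! ### Computing evil sequences with bounded fuel -/

/-- `evilStep`, computed with `s` units of fuel. -/
def evilStepn (s n : ℕ) (l : List Bool) : Option Bool :=
  if l.length < n then some false
  else if l.length = n then some true
  else ((Code.evaln s (Denumerable.ofNat Code n) (Encodable.encode (labelSample l, l.length))).bind
    fun v => (Encodable.decode v : Option Bool)).map (!·)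

theorem Primrec.evaln {α : Type*} [Primcodable α] {s : α → ℕ} {c : α → Code} {n : α → ℕ}
    (hs : Primrec s) (hc : Primrec c) (hn : Primrec n) :
    Primrec fun a => Code.evaln (s a) (c a) (n a) :=
  Primrec.comp (f := fun a : (ℕ × Code) × ℕ => Code.evaln a.1.1 a.1.2 a.2)
    (g := fun a => ((s a, c a), n a)) Code.primrec_evaln ((hs.pair hc).pair hn)

theorem primrec_evilStepn : Primrec fun a : (ℕ × ℕ) × List Bool => evilStepn a.1.1 a.1.2 a.2 := by
  have hlen : Primrec fun a : (ℕ × ℕ) × List Bool => a.2.length :=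
    Primrec.list_length.comp Primrec.snd
  have hn : Primrec fun a : (ℕ × ℕ) × List Bool => a.1.2 := Primrec.snd.comp Primrec.fst
  refine Primrec.ite (Primrec.nat_lt.comp hlen hn) (Primrec.const _)
    (Primrec.ite (Primrec.eq.comp hlen hn) (Primrec.const _) ?_)
  refine Primrec.option_map (Primrec.option_bind (Primrec.evaln
    (Primrec.fst.comp Primrec.fst) ((Primrec.ofNat Code).comp hn)
      (Primrec.encode.comp ((primrec_labelSample.comp Primrec.snd).pair hlen)))
    (Primrec.decode.comp Primrec.snd).to₂) (Primrec.not.comp Primrec.snd).to₂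

theorem Primrec.evilStepn {α : Type*} [Primcodable α] {s n : α → ℕ} {l : α → List Bool}
    (hs : Primrec s) (hn : Primrec n) (hl : Primrec l) :
    Primrec fun a => evilStepn (s a) (n a) (l a) :=
  Primrec.comp (f := fun a : (ℕ × ℕ) × List Bool => _root_.evilStepn a.1.1 a.1.2 a.2)
    (g := fun a => ((s a, n a), l a)) primrec_evilStepn ((hs.pair hn).pair hl)

theorem evilStepn_mono {s s' n : ℕ} {l : List Bool} {b : Bool} (hs : s ≤ s')
    (h : b ∈ evilStepn s n l) : b ∈ evilStepn s' n l := by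
  unfold evilStepn at h ⊢
  split_ifs at h ⊢ with h1 h2
  · exact h
  · exact h
  · simp only [Option.mem_def, Option.map_eq_some_iff, Option.bind_eq_some_iff] at h ⊢
    obtain ⟨a, ⟨v, hv, hav⟩, hab⟩ := h
    exact ⟨a, ⟨v, Code.evaln_mono hs hv, hav⟩, hab⟩

theorem mem_evilStep_iff {n : ℕ} {l : List Bool} {b : Bool} :
    b ∈ evilStep n l ↔ ∃ s, b ∈ evilStepn s n l := by
  unfold evilStep evilStepn
  split_ifs with h1 h2
  · simp [eq_comm]
  · simp [eq_comm]
  · simp only [program, Part.mem_map_iff, Part.mem_bind_iff, Part.mem_ofOption, Option.mem_def,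
      Option.map_eq_some_iff, Option.bind_eq_some_iff, Code.evaln_complete]
    constructor
    · rintro ⟨a, ⟨v, ⟨s, hv⟩, hav⟩, hab⟩
      exact ⟨s, a, ⟨v, hv, hav⟩, hab⟩
    · rintro ⟨s, a, ⟨v, hv, hav⟩, hab⟩
      exact ⟨a, ⟨v, ⟨s, hv⟩, hav⟩, hab⟩

/-- The first `k` labels of the evil sequence for the `n`-th program, where each label is computed
with `s` units of fuel. -/
def evilPrefix (s n k : ℕ) : Option (List Bool) :=
  Nat.rec (some []) (fun _ o => o.bind fun l => (evilStepn s n l).map fun b => l ++ [b]) k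

theorem evilPrefix_succ (s n k : ℕ) : evilPrefix s n (k + 1) =
    (evilPrefix s n k).bind fun l => (evilStepn s n l).map fun b => l ++ [b] := rfl

theorem primrec_evilPrefix : Primrec fun a : (ℕ × ℕ) × ℕ => evilPrefix a.1.1 a.1.2 a.2 := by
  have hstep : Primrec₂ fun (a : ((ℕ × ℕ) × ℕ) × (ℕ × Option (List Bool))) (l : List Bool) =>
      (evilStepn a.1.1.1 a.1.1.2 l).map fun b => l ++ [b] :=
    Primrec.option_map (Primrec.evilStepn
      (Primrec.fst.comp (Primrec.fst.comp (Primrec.fst.comp Primrec.fst)))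
      (Primrec.snd.comp (Primrec.fst.comp (Primrec.fst.comp Primrec.fst))) Primrec.snd)
      (Primrec.list_concat.comp (Primrec.snd.comp Primrec.fst) Primrec.snd)
  have hbind : Primrec₂ fun (a : (ℕ × ℕ) × ℕ) (p : ℕ × Option (List Bool)) =>
      p.2.bind fun l => (evilStepn a.1.1 a.1.2 l).map fun b => l ++ [b] :=
    Primrec.option_bind (Primrec.snd.comp Primrec.snd) hstep
  exact Primrec.nat_rec' Primrec.snd (Primrec.const (some [])) hbind

theorem Primrec.evilPrefix {α : Type*} [Primcodable α] {s n k : α → ℕ}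
    (hs : Primrec s) (hn : Primrec n) (hk : Primrec k) :
    Primrec fun a => evilPrefix (s a) (n a) (k a) :=
  Primrec.comp (f := fun a : (ℕ × ℕ) × ℕ => _root_.evilPrefix a.1.1 a.1.2 a.2)
    (g := fun a => ((s a, n a), k a)) primrec_evilPrefix ((hs.pair hn).pair hk)

/-- Soundness of the bounded computation; `IsEvilSequence.exists_evilPrefix` is its completeness. -/
theorem isEvilPrefix_of_evilPrefix {s n k : ℕ} {l : List Bool} (h : evilPrefix s n k = some l) :
    IsEvilPrefix n l ∧ l.length = k := by
  induction k generalizing l with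
  | zero =>
    obtain rfl : [] = l := Option.some.inj h
    exact ⟨by intro i b hb; simp at hb, rfl⟩
  | succ k ih =>
    simp only [evilPrefix_succ, Option.bind_eq_some_iff, Option.map_eq_some_iff] at h
    obtain ⟨l, hl, b, hb, rfl⟩ := h
    obtain ⟨h1, h2⟩ := ih hl
    refine ⟨fun i c hc => ?_, by simp [h2]⟩
    rcases lt_trichotomy i l.length with hi | rfl | hi
    · rw [List.getElem?_append_left hi] at hc
      rw [List.take_append_of_le_length hi.le]
      exact h1 i c hc
    · simp only [List.getElem?_concat_length, Option.mem_some_iff] at hc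
      rw [List.take_left, ← hc]
      exact mem_evilStep_iff.2 ⟨s, hb⟩
    · rw [Option.mem_def, List.getElem?_eq_none (by simpa using hi)] at hc
      cases hc

theorem IsEvilSequence.exists_evilPrefix {n : ℕ} {h : ℕ → Bool} (H : IsEvilSequence n h) (k : ℕ) :
    ∃ s, ∀ s' ≥ s, evilPrefix s' n k = some (labels h k) := by
  induction k with
  | zero => exact ⟨0, fun _ _ => rfl⟩
  | succ k ih =>
    obtain ⟨s, hs⟩ := ih
    obtain ⟨u, hu⟩ := mem_evilStep_iff.1 (isEvilSequence_iff.1 H k)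
    refine ⟨max s u, fun s' hs' => ?_⟩
    have h1 : evilStepn s' n (labels h k) = some (h k) :=
      evilStepn_mono ((le_max_right _ _).trans hs') hu
    rw [evilPrefix_succ, hs s' ((le_max_left _ _).trans hs'), Option.bind_some, h1, labels_succ]
    rfl

/-- Search for enough fuel; whatever prefix is found first has the right label by uniqueness. -/
theorem IsEvilSequence.computable {n : ℕ} {h : ℕ → Bool} (H : IsEvilSequence n h) :
    Computable h := by
  have hget : Primrec₂ fun (p : ℕ × ℕ) (l : List Bool) => l[p.1]? :=
    Primrec.list_getElem?.comp Primrec.snd (Primrec.fst.comp Primrec.fst)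
  have hp : Primrec₂ fun k s : ℕ => (evilPrefix s n (k + 1)).bind fun l => l[k]? :=
    Primrec.option_bind (Primrec.evilPrefix Primrec.snd (Primrec.const n)
      (Primrec.succ.comp Primrec.fst)) hget
  refine (Partrec.rfindOpt hp.to_comp).of_eq_tot fun k => ?_
  obtain ⟨s, hs⟩ := H.exists_evilPrefix (k + 1)
  have hd : (Nat.rfindOpt fun s => (evilPrefix s n (k + 1)).bind fun l => l[k]?).Dom := by
    rw [Nat.rfindOpt_dom]
    refine ⟨s, h k, ?_⟩
    rw [hs s le_rfl, Option.bind_some, getElem?_labels h k.lt_succ_self, Option.mem_def]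
  obtain ⟨b, hb⟩ := Part.dom_iff_mem.1 hd
  obtain ⟨u, hu⟩ := Nat.rfindOpt_spec hb
  obtain ⟨l, hl, hlb⟩ := Option.bind_eq_some_iff.1 hu
  rwa [(H.isEvilPrefix_labels (k + 1)).getElem?_unique (isEvilPrefix_of_evilPrefix hl).1
    (getElem?_labels h k.lt_succ_self) hlb]

/-- Every partial computable function is computed by some program. -/
theorem exists_program_eq {α β : Type} [Primcodable α] [Primcodable β] {f : α →. β}
    (hf : Partrec f) : ∃ n, program α β n = f := by
  obtain ⟨c, hc⟩ := Code.exists_code.1 hf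
  refine ⟨Encodable.encode c, funext fun a => ?_⟩
  simp only [program, Denumerable.ofNat_encode, hc, Encodable.encodek, Part.coe_some,
    Part.bind_some]
  ext b
  simp only [Part.mem_bind_iff, Part.mem_map_iff, Part.mem_ofOption]
  constructor
  · rintro ⟨_, ⟨c, hc, rfl⟩, h⟩
    obtain rfl : c = b := by simpa using h
    exact hc
  · exact fun h => ⟨_, ⟨b, h, rfl⟩, by simp⟩

theorem computable_of_mem_evilClass {h : ℕ → Bool} (H : h ∈ evilClass) : Computable h :=
  H.elim fun _ h => h.2.computable

/-! ### The universal online learner -/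

/-- The labels agree with the sample. -/
def Fits (l : List Bool) (S : Sample) : Prop :=
  ∀ p ∈ S, l[p.1]? = some p.2

theorem primrecRel_fits : PrimrecRel fun S l => Fits l S := by
  refine PrimrecRel.forall_mem_list (R := fun (p : ℕ × Bool) (l : List Bool) =>
    l[p.1]? = some p.2) ?_
  exact Primrec.eq.comp (Primrec.list_getElem?.comp Primrec.snd (Primrec.fst.comp Primrec.fst))
    (Primrec.option_some.comp (Primrec.snd.comp Primrec.fst))

open Classical in
/-- For `m = (n, (s, k))`, the prediction of the first `k` labels of the `n`-th program's evil
sequence, computed with `s` units of fuel, provided that they agree with the sample. -/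
noncomputable def evilGuess (p : Sample × ℕ) (m : ℕ) : Option Bool :=
  (evilPrefix m.unpair.2.unpair.1 m.unpair.1 m.unpair.2.unpair.2).bind fun l =>
    if Fits l p.1 then l[p.2]? else none

theorem primrec_evilGuess : Primrec₂ evilGuess := by
  classical
  have h2 : Primrec fun a : (Sample × ℕ) × ℕ => a.2.unpair.2.unpair :=
    Primrec.unpair.comp (Primrec.snd.comp (Primrec.unpair.comp Primrec.snd))
  have hite : Primrec₂ fun (a : (Sample × ℕ) × ℕ) (l : List Bool) =>
      if Fits l a.1.1 then l[a.1.2]? else none :=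
    Primrec.ite
      (primrecRel_fits.comp (Primrec.fst.comp (Primrec.fst.comp Primrec.fst)) Primrec.snd)
      (Primrec.list_getElem?.comp Primrec.snd (Primrec.snd.comp (Primrec.fst.comp Primrec.fst)))
      (Primrec.const _)
  exact Primrec.option_bind (Primrec.evilPrefix (Primrec.fst.comp h2)
    (Primrec.fst.comp (Primrec.unpair.comp Primrec.snd)) (Primrec.snd.comp h2)) hite

theorem mem_evilGuess {p : Sample × ℕ} {m : ℕ} {b : Bool} (h : b ∈ evilGuess p m) :
    ∃ l, IsEvilPrefix m.unpair.1 l ∧ Fits l p.1 ∧ l[p.2]? = some b := by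
  obtain ⟨l, hl, hb⟩ := Option.bind_eq_some_iff.1 h
  split_ifs at hb with hf
  exact ⟨l, (isEvilPrefix_of_evilPrefix hl).1, hf, hb⟩

theorem IsEvilSequence.exists_mem_evilGuess {n : ℕ} {h : ℕ → Bool} (H : IsEvilSequence n h)
    {S : Sample} (hS : ∀ p ∈ S, h p.1 = p.2) (x : ℕ) : ∃ m, h x ∈ evilGuess (S, x) m := by
  obtain ⟨K, hx, hK⟩ : ∃ K, x < K ∧ ∀ p ∈ S, p.1 < K := by
    -- The sum of the elements serves as a crude upper bound for each of them.
    refine ⟨(S.map Prod.fst).sum + x + 1, by omega, fun p hp => ?_⟩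
    have := List.le_sum_of_mem (List.mem_map_of_mem (f := Prod.fst) hp)
    omega
  obtain ⟨s, hs⟩ := H.exists_evilPrefix K
  refine ⟨Nat.pair n (Nat.pair s K), ?_⟩
  have hf : Fits (labels h K) S := fun p hp => by rw [getElem?_labels h (hK p hp), hS p hp]
  simp only [evilGuess, Nat.unpair_pair, hs s le_rfl, Option.bind_some, if_pos hf, Option.mem_def]
  exact getElem?_labels h hx

/-- Once a `1` has been observed, this leaves only finitely many candidate programs. -/
theorem IsEvilPrefix.le_of_getElem?_eq_true {n : ℕ} {l : List Bool} (hl : IsEvilPrefix n l)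
    {i : ℕ} (hi : l[i]? = some true) : n ≤ i := by
  by_contra hn
  have := hl i true hi
  have hlt := (List.getElem?_eq_some_iff.1 hi).1
  rw [evilStep, if_pos (by rw [List.length_take]; omega)] at this
  simp at this

open Classical in
/-- A learner for the class of evil sequences: predict `0` until the first `1` has been seen, and
from then on search for a program whose evil sequence agrees with the sample. -/
noncomputable def evilLearner : Learner := fun p =>
  Nat.rfindOpt fun m => if ∀ q ∈ p.1, q.2 = false then some false else evilGuess p m

theorem partrec_evilLearner : Partrec evilLearner := by
  classical
  have hfalse : PrimrecPred fun q : ℕ × Bool => q.2 = false :=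
    Primrec.eq.comp Primrec.snd (Primrec.const _)
  have h : Primrec₂ fun (p : Sample × ℕ) (m : ℕ) =>
      if ∀ q ∈ p.1, q.2 = false then some false else evilGuess p m :=
    Primrec.ite (hfalse.forall_mem_list.comp (Primrec.fst.comp Primrec.fst)) (Primrec.const _)
      primrec_evilGuess
  exact Partrec.rfindOpt h.to_comp

theorem mem_sample {x : ℕ → ℕ} {y : ℕ → Bool} {n : ℕ} {q : ℕ × Bool} :
    q ∈ sample x y n ↔ ∃ t < n, (x t, y t) = q := by
  simp [sample]

theorem evilLearner_learns : UniversallyOnlineLearns evilLearner evilClass := by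
  intro x y hxy
  have hdom : ∀ n, (evilLearner (sample x y n, x n)).Dom := by
    intro n
    obtain ⟨h, ⟨c, -, hc⟩, hh⟩ := hxy n
    rw [evilLearner, Nat.rfindOpt_dom]
    by_cases h0 : ∀ q ∈ sample x y n, q.2 = false
    · exact ⟨0, false, by rw [if_pos h0]; rfl⟩
    · obtain ⟨m, hm⟩ := hc.exists_mem_evilGuess (S := sample x y n) (fun q hq => by
        obtain ⟨t, ht, rfl⟩ := mem_sample.1 hq
        exact hh t ht.le) (x n)
      exact ⟨m, _, by rw [if_neg h0]; exact hm⟩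
  refine ⟨hdom, ?_⟩
  by_cases hy : ∀ t, y t = false
  · refine ⟨0, fun n _ => ?_⟩
    have h0 : ∀ q ∈ sample x y (n + 1), q.2 = false := by
      intro q hq
      obtain ⟨t, -, rfl⟩ := mem_sample.1 hq
      exact hy t
    obtain ⟨b, hb⟩ := Part.dom_iff_mem.1 (hdom (n + 1))
    obtain ⟨m, hm⟩ := Nat.rfindOpt_spec hb
    rw [if_pos h0, Option.mem_some_iff] at hm
    rwa [hy, hm]
  · push Not at hy
    obtain ⟨t₀, ht₀⟩ := hy
    rw [ne_eq, Bool.not_eq_false] at ht₀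
    -- the programs with a wrong guess after `t₀` are bounded by `x t₀`, and each errs at most once
    have herr : ∀ n, t₀ < n → y n ∉ evilLearner (sample x y n, x n) → ∃ c l, c ≤ x t₀ ∧
        IsEvilPrefix c l ∧ Fits l (sample x y n) ∧ l[x n]? = some (!y n) := by
      intro n hn hyn
      have h0 : ¬ ∀ q ∈ sample x y n, q.2 = false := fun h0 => by
        have := h0 _ (mem_sample.2 ⟨t₀, hn, rfl⟩)
        simp [ht₀] at this
      obtain ⟨b, hb⟩ := Part.dom_iff_mem.1 (hdom n)
      obtain ⟨m, hm⟩ := Nat.rfindOpt_spec hb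
      rw [if_neg h0] at hm
      obtain ⟨l, hl, hf, hlb⟩ := mem_evilGuess hm
      have hne : b ≠ y n := fun h => hyn (h ▸ hb)
      refine ⟨_, l, hl.le_of_getElem?_eq_true ?_, hl, hf, ?_⟩
      · rw [← ht₀]
        exact hf _ (mem_sample.2 ⟨t₀, hn, rfl⟩)
      · rw [← Bool.eq_not.2 hne]
        exact hlb
    choose! c l hc hl hf hlb using herr
    have hfin : {n | t₀ < n ∧ y n ∉ evilLearner (sample x y n, x n)}.Finite := by
      refine Set.Finite.of_finite_image (f := c) ((Set.finite_Iic (x t₀)).subset ?_) ?_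
      · rintro _ ⟨n, ⟨hn, hyn⟩, rfl⟩
        exact hc n hn hyn
      · have key : ∀ n n', t₀ < n → n < n' → y n ∉ evilLearner (sample x y n, x n) →
            y n' ∉ evilLearner (sample x y n', x n') → c n ≠ c n' := by
          intro n n' hn hnn' hyn hyn' hcc
          have h1 := hl n hn hyn
          rw [hcc] at h1
          -- The earlier guess has the wrong label at `x n`; the later one fits a sample that
          -- contains the true label there. Prefixes for one program cannot differ at a position.
          have := h1.getElem?_unique (hl n' (hn.trans hnn') hyn') (hlb n hn hyn)
            (hf n' (hn.trans hnn') hyn' _ (mem_sample.2 ⟨n, hnn', rfl⟩))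
          simp at this
        rintro n ⟨hn, hyn⟩ n' ⟨hn', hyn'⟩ hcc
        rcases lt_trichotomy n n' with h | h | h
        · exact (key n n' hn h hyn hyn' hcc).elim
        · exact h
        · exact (key n' n hn' h hyn' hyn hcc.symm).elim
    obtain ⟨M, hM⟩ := hfin.bddAbove
    refine ⟨max M t₀, fun n hn => ?_⟩
    by_contra hyn
    have := hM (show n + 1 ∈ _ from ⟨by omega, hyn⟩)
    omega

/-! ### The closure, and failure of enumerability -/

theorem exists_le_program_total (N : ℕ) :
    ∃ n ≥ N, ∀ p, (program (Sample × ℕ) Bool n p).Dom := by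
  -- Composing with the irrelevant `Code.const k` gives infinitely many indices for the constant
  -- function `0`, whose value decodes to a label.
  let f : ℕ → ℕ := fun k => Encodable.encode (Code.comp (Code.const 0) (Code.const k))
  have hf : Function.Injective f := by
    intro a b hab
    have := Encodable.encode_injective hab
    simp only [Code.comp.injEq, true_and] at this
    exact Code.const_inj this
  obtain ⟨k, hk⟩ : ∃ k, N ≤ f k := by
    by_contra! h
    exact Set.infinite_range_of_injective hf
      ((Set.finite_Iio N).subset (Set.range_subset_iff.2 fun k => h k))
  refine ⟨f k, hk, fun p => ?_⟩
  have h0 : ∀ x, (Code.comp (Code.const 0) (Code.const k)).eval x = Part.some 0 := by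
    intro x
    change ((Code.const k).eval x).bind (Code.const 0).eval = _
    rw [Code.eval_const]
    exact (Part.bind_some k _).trans (Code.eval_const 0 k)
  simp only [program, f, Denumerable.ofNat_encode, h0, Part.bind_some]
  trivial

theorem IsEvilSequence.index_eq {n : ℕ} {h : ℕ → Bool} (H : IsEvilSequence n h) {m : ℕ}
    (h0 : ∀ i < m, h i = false) (h1 : h m = true) : n = m := by
  rcases lt_trichotomy n m with hn | hn | hn
  · have := h0 n hn
    rw [H.2.1] at this
    cases this
  · exact hn
  · have := H.1 m hn
    rw [h1] at this
    cases this

theorem classClosure_evilClass : classClosure evilClass = evilClass ∪ {fun _ => false} := by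
  apply Set.Subset.antisymm
  · rintro g ⟨h, n, hH, hn, hg⟩
    by_cases h0 : ∀ i, g i = false
    · exact Or.inr (funext h0)
    left
    push Not at h0
    simp only [ne_eq, Bool.not_eq_false] at h0
    classical
    let m := Nat.find h0
    have key : ∀ i, m < n i → (∀ p, (program (Sample × ℕ) Bool m p).Dom) ∧
        IsEvilSequence m (h i) := by
      intro i hi
      obtain ⟨c, hc, hce⟩ := hH i
      obtain rfl : c = m := hce.index_eq
        (fun j hj => by rw [hg i j (hj.trans hi)]; simpa using Nat.find_min h0 hj)
        ((hg i m hi).trans (Nat.find_spec h0))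
      exact ⟨hc, hce⟩
    -- Approximants long enough to show the first `1` at `m` are all evil for the same index `m`, so
    -- `h (m + 1)` can represent them.
    have hm : m < n (m + 1) := hn.id_le (m + 1)
    have : g = h (m + 1) := by
      funext j
      have hj : j < n (max (m + 1) (j + 1)) :=
        lt_of_lt_of_le (by rw [id]; omega) (hn.id_le (max (m + 1) (j + 1)))
      have hmj : m < n (max (m + 1) (j + 1)) :=
        lt_of_lt_of_le (by rw [id]; omega) (hn.id_le (max (m + 1) (j + 1)))
      rw [← hg _ j hj, (key _ hmj).2.unique (key _ hm).2]
    rw [this]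
    exact hH _
  · rintro g (hg | rfl)
    · exact ⟨fun _ => g, id, fun _ => hg, strictMono_id, fun _ _ _ => rfl⟩
    · choose n hn hT using exists_le_program_total
      choose h hh using fun N => exists_isEvilSequence (hT N)
      exact ⟨h, id, fun N => ⟨_, hT N, hh N⟩, strictMono_id,
        fun N x hx => (hh N).1 x (lt_of_lt_of_le hx (hn N))⟩

theorem not_RER_evilClass : ¬ RER evilClass := by
  rintro ⟨E, hE, hEH, hHE⟩
  obtain ⟨c, hc⟩ := Code.exists_code.1 hE
  have hcE : ∀ e, E e ↔ ∃ s, (Code.evaln s c e).isSome := by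
    intro e
    have h1 : (c.eval e).Dom ↔ E e := by
      rw [hc]
      simp [Part.assert]
    rw [← h1, Part.dom_iff_mem]
    simp only [Code.evaln_complete, Option.isSome_iff_exists, Option.mem_def]
    exact exists_comm
  -- The element is read as `⟨e, ⟨s, _⟩⟩`: if `e` has been enumerated by stage `s`, copy `φ_e`,
  -- which is then total by assumption; otherwise predict `0`.
  let L : Learner := fun p =>
    bif (Code.evaln p.2.unpair.2.unpair.1 c p.2.unpair.1).isSome then
      program ℕ Bool p.2.unpair.1 p.2
    else Part.some false
  have hL : Partrec L := by
    have h1 : Primrec fun p : Sample × ℕ => p.2.unpair.1 :=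
      Primrec.fst.comp (Primrec.unpair.comp Primrec.snd)
    have h2 : Primrec fun p : Sample × ℕ => p.2.unpair.2.unpair.1 :=
      Primrec.fst.comp (Primrec.unpair.comp (Primrec.snd.comp (Primrec.unpair.comp Primrec.snd)))
    have hev : Partrec fun p : Sample × ℕ =>
        (Denumerable.ofNat Code p.2.unpair.1).eval (Encodable.encode p.2) :=
      Code.eval_part.comp ((Computable.ofNat Code).comp h1.to_comp)
        (Computable.encode.comp Computable.snd)
    have hdec : Partrec₂ fun (_ : Sample × ℕ) (k : ℕ) =>
        (Encodable.decode (α := Bool) k : Part Bool) :=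
      (Computable.decode.comp Computable.snd).ofOption
    have hif : Primrec fun p : Sample × ℕ =>
        (Code.evaln p.2.unpair.2.unpair.1 c p.2.unpair.1).isSome :=
      Primrec.option_isSome.comp (Primrec.evaln h2 (Primrec.const c) h1)
    exact Partrec.cond hif.to_comp (hev.bind hdec) (Computable.const false).partrec
  have hTot : ∀ p, (L p).Dom := by
    intro p
    by_cases h : (Code.evaln p.2.unpair.2.unpair.1 c p.2.unpair.1).isSome
    · obtain ⟨g, -, hg⟩ := hEH _ ((hcE _).2 ⟨_, h⟩)
      simp only [L, h, cond_true, hg]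
      trivial
    · simp only [L, h, cond_false]
      trivial
  obtain ⟨n, hn⟩ := exists_program_eq hL
  have hTot' : ∀ p, (program (Sample × ℕ) Bool n p).Dom := by rwa [hn]
  obtain ⟨h, hh⟩ := exists_isEvilSequence hTot'
  obtain ⟨e, hEe, he⟩ := hHE h ⟨n, hTot', hh⟩
  obtain ⟨s, hs⟩ := (hcE e).1 hEe
  -- The free third component moves the element beyond `n`, where the evil sequence must contradict
  -- the learner; but there the learner copies `φ_e = h`.
  have hk : n < Nat.pair e (Nat.pair s (n + 1)) :=
    (Nat.lt_succ_self n).trans_le ((Nat.right_le_pair _ _).trans (Nat.right_le_pair _ _))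
  have := hh.2.2 _ hk
  rw [hn] at this
  simp [L, hs, he] at this

/-! ### Approximating randomized programs from finitely many bits -/

/-- A functional with access to the bits of `r` is approximated by a primitive recursive function of
the finite initial segments of `r`; the length of the segment also bounds the searches. -/
theorem BitPartrec.exists_primrec {F : (ℕ → Bool) → ℕ →. ℕ} (hF : BitPartrec F) :
    ∃ f : List Bool → ℕ → Option ℕ, Primrec₂ f ∧
      (∀ l l' n v, l <+: l' → f l n = some v → f l' n = some v) ∧
      ∀ r n v, v ∈ F r n ↔ ∃ d, f (labels r d) n = some v := by
  induction hF with
  | zero => exact ⟨fun _ _ => some 0, Primrec₂.const _, fun _ _ _ _ _ h => h, fun _ _ _ => by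
      simp [eq_comm]⟩
  | succ => exact ⟨fun _ n => some (n + 1),
      Primrec.option_some.comp (Primrec.succ.comp Primrec.snd), fun _ _ _ _ _ h => h,
      fun _ _ _ => by simp [eq_comm]⟩
  | left => exact ⟨fun _ n => some n.unpair.1,
      Primrec.option_some.comp (Primrec.fst.comp (Primrec.unpair.comp Primrec.snd)),
      fun _ _ _ _ _ h => h, fun _ _ _ => by simp [eq_comm]⟩
  | right => exact ⟨fun _ n => some n.unpair.2,
      Primrec.option_some.comp (Primrec.snd.comp (Primrec.unpair.comp Primrec.snd)),
      fun _ _ _ _ _ h => h, fun _ _ _ => by simp [eq_comm]⟩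
  | bit =>
    refine ⟨fun l n => l[n]?.map Bool.toNat, ?_, ?_, ?_⟩
    · exact Primrec.option_map (Primrec.list_getElem?.comp Primrec.fst Primrec.snd)
        ((Primrec.dom_finite Bool.toNat).comp Primrec.snd).to₂
    · rintro l _ n v ⟨t, rfl⟩ h
      obtain ⟨b, hb, hv⟩ := Option.map_eq_some_iff.1 h
      refine Option.map_eq_some_iff.2 ⟨b, ?_, hv⟩
      rwa [List.getElem?_append_left (List.getElem?_eq_some_iff.1 hb).1]
    · intro r n v
      rw [Part.mem_some_iff]
      constructor
      · rintro rfl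
        exact ⟨n + 1, Option.map_eq_some_iff.2 ⟨_, getElem?_labels r n.lt_succ_self, rfl⟩⟩
      · rintro ⟨d, hd⟩
        obtain ⟨b, hb, rfl⟩ := Option.map_eq_some_iff.1 hd
        have hn : n < d := by simpa using (List.getElem?_eq_some_iff.1 hb).1
        rw [getElem?_labels r hn] at hb
        rw [Option.some.inj hb]
  | @pair F G _ _ ihF ihG =>
    obtain ⟨f, hf, mf, cf⟩ := ihF
    obtain ⟨g, hg, mg, cg⟩ := ihG
    refine ⟨fun l n => (f l n).bind fun a => (g l n).map fun b => Nat.pair a b, ?_, ?_, ?_⟩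
    · have h : Primrec₂ fun (p : List Bool × ℕ) (a : ℕ) =>
          (g p.1 p.2).map fun b => Nat.pair a b :=
        Primrec.option_map (hg.comp (Primrec.fst.comp Primrec.fst) (Primrec.snd.comp Primrec.fst))
          (Primrec₂.natPair.comp (Primrec.snd.comp Primrec.fst) Primrec.snd)
      exact Primrec.option_bind hf h
    · intro l l' n v hl h
      simp only [Option.bind_eq_some_iff, Option.map_eq_some_iff] at h ⊢
      obtain ⟨a, ha, b, hb, rfl⟩ := h
      exact ⟨a, mf _ _ _ _ hl ha, b, mg _ _ _ _ hl hb, rfl⟩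
    · intro r n v
      simp only [Option.bind_eq_some_iff, Option.map_eq_some_iff, Seq.seq, Part.map_eq_map,
        Part.mem_bind_iff, Part.mem_map_iff, Part.bind_map]
      constructor
      · rintro ⟨a, ha, b, hb, rfl⟩
        obtain ⟨d, hd⟩ := (cf _ _ _).1 ha
        obtain ⟨e, he⟩ := (cg _ _ _).1 hb
        exact ⟨max d e, a, mf _ _ _ _ (labels_prefix r (le_max_left _ _)) hd, b,
          mg _ _ _ _ (labels_prefix r (le_max_right _ _)) he, rfl⟩
      · rintro ⟨d, a, ha, b, hb, rfl⟩
        exact ⟨a, (cf _ _ _).2 ⟨d, ha⟩, b, (cg _ _ _).2 ⟨d, hb⟩, rfl⟩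
  | @comp F G _ _ ihF ihG =>
    obtain ⟨f, hf, mf, cf⟩ := ihF
    obtain ⟨g, hg, mg, cg⟩ := ihG
    refine ⟨fun l n => (g l n).bind fun a => f l a, ?_, ?_, ?_⟩
    · exact Primrec.option_bind hg (hf.comp (Primrec.fst.comp Primrec.fst) Primrec.snd)
    · intro l l' n v hl h
      simp only [Option.bind_eq_some_iff] at h ⊢
      obtain ⟨a, ha, hb⟩ := h
      exact ⟨a, mg _ _ _ _ hl ha, mf _ _ _ _ hl hb⟩
    · intro r n v
      refine (Part.mem_bind_iff (f := G r n) (g := F r)).trans ?_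
      simp only [Option.bind_eq_some_iff]
      constructor
      · rintro ⟨a, ha, hb⟩
        obtain ⟨d, hd⟩ := (cg _ _ _).1 ha
        obtain ⟨e, he⟩ := (cf _ _ _).1 hb
        exact ⟨max d e, a, mg _ _ _ _ (labels_prefix r (le_max_left _ _)) hd,
          mf _ _ _ _ (labels_prefix r (le_max_right _ _)) he⟩
      · rintro ⟨d, a, ha, hb⟩
        exact ⟨a, (cg _ _ _).2 ⟨d, ha⟩, (cf _ _ _).2 ⟨d, hb⟩⟩
  | @prec F G _ _ ihF ihG =>
    obtain ⟨f, hf, mf, cf⟩ := ihF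
    obtain ⟨g, hg, mg, cg⟩ := ihG
    let f' : List Bool → ℕ → ℕ → Option ℕ := fun l a n =>
      n.rec (f l a) fun y o => o.bind fun i => g l (Nat.pair a (Nat.pair y i))
    have f'_succ : ∀ l a n, f' l a (n + 1) =
        (f' l a n).bind fun i => g l (Nat.pair a (Nat.pair n i)) := fun _ _ _ => rfl
    have mf' : ∀ a n l l' v, l <+: l' → f' l a n = some v → f' l' a n = some v := by
      intro a n
      induction n with
      | zero => exact fun l l' v hl h => mf _ _ _ _ hl h
      | succ n ih =>
        intro l l' v hl h
        simp only [f'_succ, Option.bind_eq_some_iff] at h ⊢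
        obtain ⟨i, hi, hv⟩ := h
        exact ⟨i, ih _ _ _ hl hi, mg _ _ _ _ hl hv⟩
    refine ⟨fun l n => f' l n.unpair.1 n.unpair.2, ?_, fun l l' n v => mf' _ _ _ _ _, ?_⟩
    · have h1 : Primrec fun p : List Bool × ℕ => p.2.unpair.1 :=
        Primrec.fst.comp (Primrec.unpair.comp Primrec.snd)
      have h2 : Primrec fun p : List Bool × ℕ => p.2.unpair.2 :=
        Primrec.snd.comp (Primrec.unpair.comp Primrec.snd)
      have h3 : Primrec₂ fun (q : (List Bool × ℕ) × (ℕ × Option ℕ)) (i : ℕ) =>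
          g q.1.1 (Nat.pair q.1.2.unpair.1 (Nat.pair q.2.1 i)) :=
        hg.comp (Primrec.fst.comp (Primrec.fst.comp Primrec.fst))
          (Primrec₂.natPair.comp (h1.comp (Primrec.fst.comp Primrec.fst))
            (Primrec₂.natPair.comp (Primrec.fst.comp (Primrec.snd.comp Primrec.fst)) Primrec.snd))
      have h4 : Primrec₂ fun (p : List Bool × ℕ) (q : ℕ × Option ℕ) =>
          q.2.bind fun i => g p.1 (Nat.pair p.2.unpair.1 (Nat.pair q.1 i)) :=
        Primrec.option_bind (Primrec.snd.comp Primrec.snd) h3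
      exact Primrec.nat_rec' h2 (hf.comp Primrec.fst h1) h4
    · intro r n v
      simp only [Nat.unpaired]
      generalize n.unpair.1 = a
      induction n.unpair.2 generalizing v with
      | zero => exact cf r a v
      | succ n ih =>
        simp only [Part.bind_eq_bind, Part.mem_bind_iff, f'_succ, Option.bind_eq_some_iff] at ih ⊢
        constructor
        · rintro ⟨i, hi, hv⟩
          obtain ⟨d, hd⟩ := (ih _).1 hi
          obtain ⟨e, he⟩ := (cg _ _ _).1 hv
          exact ⟨max d e, i, mf' _ _ _ _ _ (labels_prefix r (le_max_left _ _)) hd,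
            mg _ _ _ _ (labels_prefix r (le_max_right _ _)) he⟩
        · rintro ⟨d, i, hi, hv⟩
          exact ⟨i, (ih _).2 ⟨d, hi⟩, (cg _ _ _).2 ⟨d, hv⟩⟩
  | @rfind F _ ihF =>
    obtain ⟨f, hf, mf, cf⟩ := ihF
    -- The default `0` makes an undefined earlier value count as failure, so `≠ 0` means defined and
    -- nonzero. Hence `good` persists when the segment grows.
    let good : ℕ → List Bool × ℕ → Prop := fun n p =>
      f p.1 (Nat.pair p.2 n) = some 0 ∧ ∀ m < n, (f p.1 (Nat.pair p.2 m)).getD 0 ≠ 0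
    have good_mono : ∀ l l' a n, l <+: l' → good n (l, a) → good n (l', a) := by
      rintro l l' a n hl ⟨h1, h2⟩
      refine ⟨mf _ _ _ _ hl h1, fun m hm => ?_⟩
      have := h2 m hm
      obtain ⟨v, hv⟩ : ∃ v, f l (Nat.pair a m) = some v := by
        rw [← Option.isSome_iff_exists]
        by_contra hn
        simp [Option.not_isSome_iff_eq_none.1 hn] at this
      simpa [hv, mf _ _ _ _ hl hv] using this
    have good_unique : ∀ p n n', good n p → good n' p → n = n' := by
      rintro p n n' ⟨h1, h2⟩ ⟨h1', h2'⟩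
      rcases lt_trichotomy n n' with h | h | h
      · exact absurd (by simp [h1]) (h2' n h)
      · exact h
      · exact absurd (by simp [h1']) (h2 n' h)
    have prim_good : PrimrecRel good := by
      have hp : Primrec fun q : ℕ × (List Bool × ℕ) => f q.2.1 (Nat.pair q.2.2 q.1) :=
        hf.comp (Primrec.fst.comp Primrec.snd)
          (Primrec₂.natPair.comp (Primrec.snd.comp Primrec.snd) Primrec.fst)
      have h0 : PrimrecRel fun (m : ℕ) (p : List Bool × ℕ) =>
          (f p.1 (Nat.pair p.2 m)).getD 0 ≠ 0 :=
        (Primrec.eq.comp (Primrec.option_getD.comp hp (Primrec.const 0)) (Primrec.const 0)).not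
      have h1 : PrimrecPred fun q : ℕ × (List Bool × ℕ) =>
          ∀ m < q.1, (f q.2.1 (Nat.pair q.2.2 m)).getD 0 ≠ 0 :=
        (h0.forall_mem_list.comp (Primrec.list_range.comp Primrec.fst) Primrec.snd).of_eq
          fun q => by simp only [List.mem_range]
      exact (Primrec.eq.comp hp (Primrec.const (some 0))).and h1
    classical
    let f' : List Bool → ℕ → Option ℕ := fun l a =>
      ((List.range l.length).filter fun n => good n (l, a)).head?
    have f'_iff : ∀ l a v, f' l a = some v ↔ v < l.length ∧ good v (l, a) := by
      intro l a v
      constructor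
      · intro h
        simpa using List.mem_of_mem_head? h
      · rintro ⟨h1, h2⟩
        have hv : v ∈ (List.range l.length).filter fun n => good n (l, a) := by simp [h1, h2]
        obtain ⟨w, hw⟩ : ∃ w, f' l a = some w := by
          rw [← Option.isSome_iff_exists, List.isSome_head?]
          exact List.ne_nil_of_mem hv
        have hw' : w < l.length ∧ good w (l, a) := by simpa using List.mem_of_mem_head? hw
        rw [hw, good_unique _ _ _ hw'.2 h2]
    refine ⟨f', ?_, ?_, ?_⟩
    · exact Primrec.list_head?.comp
        (prim_good.listFilter.comp (Primrec.list_range.comp (Primrec.list_length.comp Primrec.fst))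
          Primrec.id)
    · intro l l' a v hl h
      rw [f'_iff] at h ⊢
      exact ⟨h.1.trans_le hl.length_le, good_mono _ _ _ _ hl h.2⟩
    · intro r a v
      refine Nat.mem_rfind.trans ?_
      simp only [f'_iff, length_labels, Part.map_eq_map, Part.mem_map_iff,
        decide_eq_true_eq, decide_eq_false_iff_not]
      constructor
      · rintro ⟨⟨_, hz, rfl⟩, h2⟩
        obtain ⟨d, hd⟩ := (cf _ _ _).1 hz
        have : ∀ m, ∃ d, m < v → (f (labels r d) (Nat.pair a m)).getD 0 ≠ 0 := by
          intro m
          by_cases hm : m < v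
          · obtain ⟨w, hw, hw0⟩ := h2 hm
            obtain ⟨e, he⟩ := (cf _ _ _).1 hw
            exact ⟨e, fun _ => by simpa [he] using hw0⟩
          · exact ⟨0, fun h => absurd h hm⟩
        choose e he using this
        -- One segment long enough for the zero at `v`, for all earlier values, and for the search
        -- bound.
        obtain ⟨D, hdD, hvD, heD⟩ : ∃ D, d ≤ D ∧ v < D ∧ ∀ m < v, e m ≤ D :=
          ⟨d + (v + 1) + (Finset.range v).sup e, by omega, by omega, fun m hm =>
            (Finset.le_sup (Finset.mem_range.2 hm)).trans (Nat.le_add_left _ _)⟩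
        refine ⟨D, hvD, mf _ _ _ _ (labels_prefix r hdD) hd, fun m hm => ?_⟩
        have hem := he m hm
        obtain ⟨w, hw⟩ : ∃ w, f (labels r (e m)) (Nat.pair a m) = some w := by
          rw [← Option.isSome_iff_exists]
          by_contra hn
          simp [Option.not_isSome_iff_eq_none.1 hn] at hem
        simpa [hw, mf _ _ _ _ (labels_prefix r (heD m hm)) hw] using hem
      · rintro ⟨d, hvd, h1, h2⟩
        refine ⟨⟨0, (cf _ _ _).2 ⟨d, h1⟩, rfl⟩, fun {m} hm => ?_⟩
        have := h2 m hm
        cases hfm : f (labels r d) (Nat.pair a m) with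
        | none => simp [hfm] at this
        | some w => exact ⟨w, (cf _ _ _).2 ⟨d, hfm⟩, by simpa [hfm] using this⟩

/-! ### Fair-coin probabilities as counts of bit strings -/

/-- All bit strings of length `d`. -/
def bitStrings (d : ℕ) : List (List Bool) :=
  Nat.rec [[]] (fun _ L => L.flatMap fun l => [l ++ [false], l ++ [true]]) d

theorem bitStrings_succ (d : ℕ) :
    bitStrings (d + 1) = (bitStrings d).flatMap fun l => [l ++ [false], l ++ [true]] := rfl

theorem primrec_bitStrings : Primrec bitStrings := by
  have h1 : ∀ b : Bool, Primrec₂ fun (_ : ℕ × List (List Bool)) (l : List Bool) => l ++ [b] :=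
    fun b => Primrec.list_concat.comp Primrec.snd (Primrec.const b)
  have h2 : Primrec₂ fun (_ : ℕ × List (List Bool)) (l : List Bool) =>
      [l ++ [false], l ++ [true]] :=
    Primrec.list_cons.comp (h1 false) (Primrec.list_cons.comp (h1 true) (Primrec.const []))
  have h3 : Primrec₂ fun (_ : ℕ) (L : List (List Bool)) =>
      L.flatMap fun l => [l ++ [false], l ++ [true]] :=
    Primrec.list_flatMap Primrec.snd h2
  exact Primrec.nat_rec₁ [[]] h3

theorem length_bitStrings (d : ℕ) : (bitStrings d).length = 2 ^ d := by
  induction d with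
  | zero => rfl
  | succ d ih => simp [bitStrings_succ, List.length_flatMap, ih, pow_succ]

theorem mem_bitStrings {d : ℕ} {l : List Bool} : l ∈ bitStrings d ↔ l.length = d := by
  induction d generalizing l with
  | zero => simp [bitStrings]
  | succ d ih =>
    simp only [bitStrings_succ, List.mem_flatMap, ih, List.mem_cons, List.not_mem_nil, or_false]
    constructor
    · rintro ⟨l, rfl, rfl | rfl⟩ <;> simp
    · intro h
      obtain rfl | ⟨l, b, rfl⟩ := List.eq_nil_or_concat' l
      · simp at h
      · exact ⟨l, by simpa using h, by cases b <;> simp⟩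

theorem nodup_bitStrings (d : ℕ) : (bitStrings d).Nodup := by
  induction d with
  | zero => simp [bitStrings]
  | succ d ih =>
    rw [bitStrings_succ, List.nodup_flatMap]
    refine ⟨fun l _ => by simp, ih.imp fun {l l'} hne => ?_⟩
    simp only [Function.onFun, List.disjoint_left, List.mem_cons, List.not_mem_nil, or_false]
    rintro _ (rfl | rfl) <;> simp [hne]

instance : IsProbabilityMeasure fairBits := by
  unfold fairBits
  infer_instance

theorem setOf_labels_eq {d : ℕ} {l : List Bool} (hl : l.length = d) :
    {r | labels r d = l} = Set.pi (Finset.range d) fun i => {l.getD i false} := by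
  ext r
  simp only [Set.mem_ofPred_eq, Set.mem_pi, Finset.coe_range, Set.mem_Iio, Set.mem_singleton_iff]
  constructor
  · rintro rfl i hi
    simp [List.getD_eq_getElem?_getD, getElem?_labels r hi]
  · intro h
    refine List.ext_getElem (by simp [hl]) fun i h1 h2 => ?_
    have hi : i < d := hl ▸ h2
    have := h i hi
    rw [List.getD_eq_getElem _ _ h2] at this
    rw [← this]
    simp [labels]

theorem measurableSet_labels_eq {d : ℕ} {l : List Bool} (hl : l.length = d) :
    MeasurableSet {r | labels r d = l} := by
  rw [setOf_labels_eq hl]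
  exact MeasurableSet.pi (Finset.countable_toSet _) fun _ _ => measurableSet_singleton _

theorem fairBits_labels_eq {d : ℕ} {l : List Bool} (hl : l.length = d) :
    fairBits {r | labels r d = l} = 2⁻¹ ^ d := by
  rw [setOf_labels_eq hl, fairBits, Measure.infinitePi_pi _ fun _ _ => measurableSet_singleton _]
  simp

theorem setOf_labels (P : List Bool → Prop) [DecidablePred P] (d : ℕ) :
    {r | P (labels r d)} = ⋃ l ∈ ((bitStrings d).filter P).toFinset, {r | labels r d = l} := by
  ext r
  simp [mem_bitStrings]

theorem measurableSet_labels (P : List Bool → Prop) (d : ℕ) :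
    MeasurableSet {r | P (labels r d)} := by
  classical
  rw [setOf_labels]
  refine Finset.measurableSet_biUnion _ fun l hl => measurableSet_labels_eq ?_
  simp only [List.mem_toFinset, List.mem_filter, mem_bitStrings] at hl
  exact hl.1

/-- The probability of an event about the first `d` random bits, as a proportion of bit strings. -/
theorem fairBits_labels (P : List Bool → Prop) [DecidablePred P] (d : ℕ) :
    fairBits {r | P (labels r d)} = ((bitStrings d).filter P).length * 2⁻¹ ^ d := by
  have hlen : ∀ l ∈ ((bitStrings d).filter P).toFinset, l.length = d := by
    intro l hl
    simp only [List.mem_toFinset, List.mem_filter, mem_bitStrings] at hl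
    exact hl.1
  rw [setOf_labels, measure_biUnion_finset]
  · rw [Finset.sum_congr rfl fun l hl => fairBits_labels_eq (hlen l hl), Finset.sum_const,
      List.toFinset_card_of_nodup ((nodup_bitStrings d).filter _), nsmul_eq_mul]
  · intro l _ l' _ hne
    rw [Function.onFun, Set.disjoint_left]
    rintro r rfl rfl
    exact hne rfl
  · exact fun l hl => measurableSet_labels_eq (hlen l hl)

/-- The right side is an inequality between natural numbers, so the probability threshold can be
tested by a program. -/
theorem fairBits_labels_ge_iff (P : List Bool → Prop) [DecidablePred P] (d : ℕ) :
    4⁻¹ ≤ fairBits {r | P (labels r d)} ↔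
      (bitStrings d).length ≤ 4 * ((bitStrings d).filter P).length := by
  rw [fairBits_labels, length_bitStrings, ← ENNReal.inv_pow, ← div_eq_mul_inv,
    ENNReal.le_div_iff_mul_le (by simp) (by simp), mul_comm, ← div_eq_mul_inv,
    ENNReal.div_le_iff_le_mul (by simp) (by simp)]
  norm_cast
  rw [mul_comm]

/-! ### Derandomization -/

theorem RandomizedLearner.IsComputable.exists_primrec {L : RandomizedLearner}
    (hL : L.IsComputable) : ∃ f : List Bool → Sample × ℕ → Option Bool, Primrec₂ f ∧
      (∀ l l' p b, l <+: l' → f l p = some b → f l' p = some b) ∧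
      ∀ r p b, b ∈ L r p ↔ ∃ d, f (labels r d) p = some b := by
  obtain ⟨f, hf, mf, cf⟩ := BitPartrec.exists_primrec hL
  refine ⟨fun l p => (f l (Encodable.encode p)).bind fun k => Encodable.decode k, ?_, ?_, ?_⟩
  · have hdec : Primrec₂ fun (_ : List Bool × (Sample × ℕ)) (k : ℕ) =>
        (Encodable.decode k : Option Bool) := Primrec.decode.comp Primrec.snd
    exact Primrec.option_bind (hf.comp Primrec.fst (Primrec.encode.comp Primrec.snd)) hdec
  · intro l l' p b hl h
    simp only [Option.bind_eq_some_iff] at h ⊢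
    obtain ⟨k, hk, hb⟩ := h
    exact ⟨k, mf _ _ _ _ hl hk, hb⟩
  · intro r p b
    have key : ∀ v, (v ∈ (L r p).map Encodable.encode) ↔
        ∃ d, f (labels r d) (Encodable.encode p) = some v := by
      intro v
      rw [← cf r (Encodable.encode p) v, Encodable.encodek, Part.coe_some, Part.bind_some]
    simp only [Option.bind_eq_some_iff]
    constructor
    · intro hb
      obtain ⟨d, hd⟩ := (key _).1 (Part.mem_map _ hb)
      exact ⟨d, _, hd, Encodable.encodek b⟩
    · rintro ⟨d, k, hk, hb⟩
      obtain ⟨c, hc, rfl⟩ := (Part.mem_map_iff _).1 ((key k).2 ⟨d, hk⟩)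
      rw [Encodable.encodek, Option.some.injEq] at hb
      exact hb ▸ hc

theorem RandomizedLearner.IsComputable.measurableSet {L : RandomizedLearner}
    (hL : L.IsComputable) (p : Sample × ℕ) (b : Bool) : MeasurableSet {r | b ∈ L r p} := by
  obtain ⟨f, -, -, cf⟩ := hL.exists_primrec
  simp only [cf, Set.ofPred_exists]
  exact MeasurableSet.iUnion fun d => measurableSet_labels (fun l => f l p = some b) d

/-- An almost total randomized computable learner can be replaced by a total computable one whose
predictions are predictions of the randomized learner with probability at least `1/4`. -/
theorem RandomizedLearner.exists_derandomization {L : RandomizedLearner} (hL : L.IsComputable)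
    (hT : L.AlmostTotal) : ∃ D : Learner, Partrec D ∧ (∀ p, (D p).Dom) ∧
      ∀ p, ∀ b ∈ D p, 4⁻¹ ≤ fairBits {r | b ∈ L r p} := by
  obtain ⟨f, hf, mf, cf⟩ := hL.exists_primrec
  let often : ℕ → (Sample × ℕ) × Bool → Prop := fun d q =>
    (bitStrings d).length ≤ 4 * ((bitStrings d).filter fun l => f l q.1 = some q.2).length
  have often_iff : ∀ d p b, often d (p, b) ↔ 4⁻¹ ≤ fairBits {r | f (labels r d) p = some b} :=
    fun d p b => (fairBits_labels_ge_iff (fun l => f l p = some b) d).symm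
  have prim_often : PrimrecRel often := by
    have h1 : PrimrecRel fun (l : List Bool) (q : (Sample × ℕ) × Bool) => f l q.1 = some q.2 :=
      Primrec.eq.comp (hf.comp Primrec.fst (Primrec.fst.comp Primrec.snd))
        (Primrec.option_some.comp (Primrec.snd.comp Primrec.snd))
    have h2 : Primrec fun q : ℕ × ((Sample × ℕ) × Bool) =>
        (bitStrings q.1).filter fun l => f l q.2.1 = some q.2.2 :=
      h1.listFilter.comp (primrec_bitStrings.comp Primrec.fst) Primrec.snd
    exact Primrec.nat_le.comp
      (Primrec.list_length.comp (primrec_bitStrings.comp Primrec.fst))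
      (Primrec.nat_mul.comp (Primrec.const 4) (Primrec.list_length.comp h2))
  classical
  let g : Sample × ℕ → ℕ → Option Bool := fun p d =>
    if often d (p, true) then some true else if often d (p, false) then some false else none
  have prim_g : Primrec₂ g := by
    have h1 : ∀ b : Bool, PrimrecPred fun q : (Sample × ℕ) × ℕ => often q.2 (q.1, b) := fun b =>
      prim_often.comp Primrec.snd (Primrec.fst.pair (Primrec.const b))
    exact Primrec.ite (h1 true) (Primrec.const _)
      (Primrec.ite (h1 false) (Primrec.const _) (Primrec.const _))
  refine ⟨fun p => Nat.rfindOpt (g p), Partrec.rfindOpt prim_g.to_comp, fun p => ?_,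
    fun p b hb => ?_⟩
  · rw [Nat.rfindOpt_dom]
    -- If no label ever reached the threshold, continuity from below would give each label
    -- probability at most `1/4`, in total at most `1/2`, against almost sure halting. Any threshold
    -- below `1/2` would do.
    by_contra hnone
    have hle : ∀ b, fairBits {r | b ∈ L r p} ≤ 4⁻¹ := by
      intro b
      have hU : {r | b ∈ L r p} = ⋃ d, {r | f (labels r d) p = some b} := by
        ext r
        simp [cf]
      have hmono : Monotone fun d => {r | f (labels r d) p = some b} :=
        fun d e hde r hr => mf _ _ _ _ (labels_prefix r hde) hr
      rw [hU, hmono.measure_iUnion]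
      refine iSup_le fun d => ?_
      by_contra hlt
      have hd : often d (p, b) := (often_iff d p b).2 (not_le.1 hlt).le
      apply hnone
      by_cases ht : often d (p, true)
      · exact ⟨d, true, by simp [g, ht]⟩
      · cases b with
        | true => exact absurd hd ht
        | false => exact ⟨d, false, by simp [g, ht, hd]⟩
    have hone : fairBits ({r | true ∈ L r p} ∪ {r | false ∈ L r p}) = 1 := by
      rw [prob_compl_eq_zero_iff ((hL.measurableSet p true).union (hL.measurableSet p false)) |>.symm]
      refine measure_mono_null ?_ (ae_iff.1 hT)
      intro r hr hdom
      obtain ⟨b, hb⟩ := Part.dom_iff_mem.1 (hdom p)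
      cases b with
      | true => exact hr (Or.inl hb)
      | false => exact hr (Or.inr hb)
    have h2 := (measure_union_le (μ := fairBits) {r | true ∈ L r p} {r | false ∈ L r p}).trans
      (add_le_add (hle true) (hle false))
    rw [hone, ← ENNReal.toReal_le_toReal (by simp) (by simp), ENNReal.toReal_add (by simp)
      (by simp)] at h2
    norm_num at h2
  · obtain ⟨d, hd⟩ := Nat.rfindOpt_spec hb
    have : often d (p, b) := by
      simp only [g] at hd
      split_ifs at hd with h1 h2
      · obtain rfl : true = b := Option.some.inj hd
        exact h1
      · obtain rfl : false = b := Option.some.inj hd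
        exact h2
      · cases hd
    exact ((often_iff d p b).1 this).trans (measure_mono fun r hr => (cf r p b).2 ⟨d, hr⟩)

/-! ### Linear regret on an evil sequence -/

theorem Learner.mistakes_eq_sum (L : Learner) (x : ℕ → ℕ) (y : ℕ → Bool) (n : ℕ) :
    (L.mistakes x y n : ℝ) =
      ∑ t ∈ Finset.Icc 1 n, {L : Learner | y t ∉ L (sample x y t, x t)}.indicator 1 L := by
  classical
  have : {t : ℕ | 0 < t ∧ t ≤ n ∧ y t ∉ L (sample x y t, x t)} =
      ((Finset.Icc 1 n).filter fun t => y t ∉ L (sample x y t, x t) : Finset ℕ) := by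
    ext t
    simp [Nat.succ_le_iff, and_assoc]
  rw [Learner.mistakes, this, Set.ncard_coe_finset, Finset.card_filter]
  push_cast
  exact Finset.sum_congr rfl fun t _ => by simp [Set.indicator_apply]

theorem bestMistakes_eq_zero {H : Set (ℕ → Bool)} {h : ℕ → Bool} (hh : h ∈ H) (n : ℕ) :
    bestMistakes H id h n = 0 :=
  Nat.le_zero.1 (Nat.sInf_le ⟨h, hh, by simp [hypothesisMistakes]⟩)

theorem not_agnosticallyLearnable_evilClass :
    ¬ ComputablyAgnosticallyLearnable evilClass := by
  rintro ⟨L, hL, hT, hA⟩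
  obtain ⟨D, hD, hDT, hDL⟩ := RandomizedLearner.exists_derandomization hL hT
  obtain ⟨n, rfl⟩ := exists_program_eq hD
  obtain ⟨h, hh⟩ := exists_isEvilSequence hDT
  have hmem : h ∈ evilClass := ⟨n, hDT, hh⟩
  let B : ℕ → Set (ℕ → Bool) := fun t => {r | h t ∉ L r (sample id h t, t)}
  have hBm : ∀ t, MeasurableSet (B t) := fun t => (hL.measurableSet _ _).compl
  have hB : ∀ t > n, 1 / 4 ≤ fairBits.real (B t) := by
    intro t ht
    have h1 : (4⁻¹ : ENNReal) ≤ fairBits (B t) := by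
      -- `D` predicts `!h t` here, so `L` makes this wrong prediction with probability at least
      -- `1/4`.
      refine (hDL _ _ (hh.2.2 t ht)).trans (measure_mono fun r hr hr' => ?_)
      simpa using Part.mem_unique hr hr'
    have h2 := ENNReal.toReal_mono (measure_ne_top fairBits (B t)) h1
    simpa [Measure.real] using h2
  have hreg : ∀ N : ℕ, ((N : ℝ) - n) / 4 ≤ expectedRegret L evilClass id h N := by
    intro N
    have h1 : expectedRegret L evilClass id h N = ∑ t ∈ Finset.Icc 1 N, fairBits.real (B t) := by
      have h2 : ∀ r, (((L r).mistakes id h N : ℝ) - (bestMistakes evilClass id h N : ℝ)) =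
          ∑ t ∈ Finset.Icc 1 N, (B t).indicator 1 r := by
        intro r
        rw [bestMistakes_eq_zero hmem, Nat.cast_zero, sub_zero, Learner.mistakes_eq_sum]
        rfl
      simp only [expectedRegret, h2]
      rw [integral_finsetSum (f := fun t => (B t).indicator 1) _ fun t _ =>
        (integrable_const (1 : ℝ)).indicator (hBm t)]
      exact Finset.sum_congr rfl fun t _ => integral_indicator_one (hBm t)
    rw [h1]
    calc ((N : ℝ) - n) / 4 ≤ ((N - n : ℕ) : ℝ) * (1 / 4) := by
          have : (N : ℝ) ≤ (N - n : ℕ) + n := by exact_mod_cast (by omega : N ≤ N - n + n)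
          linarith
      _ = ∑ t ∈ Finset.Ioc n N, (1 / 4 : ℝ) := by simp
      _ ≤ ∑ t ∈ Finset.Ioc n N, fairBits.real (B t) :=
          Finset.sum_le_sum fun t ht => hB t (Finset.mem_Ioc.1 ht).1
      _ ≤ ∑ t ∈ Finset.Icc 1 N, fairBits.real (B t) := by
          refine Finset.sum_le_sum_of_subset_of_nonneg (fun t ht => ?_)
            fun _ _ _ => measureReal_nonneg
          rw [Finset.mem_Ioc] at ht
          rw [Finset.mem_Icc]
          omega
  obtain ⟨N, hN, hN'⟩ :=
    -- For `N > 2n` the lower bound `(N - n) / 4` exceeds `N / 8`.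
    ((hA id h (1 / 8) (by norm_num)).and (eventually_gt_atTop (2 * n))).exists
  have h1 := (hreg N).trans hN
  have h2 : (2 * n : ℝ) < N := by exact_mod_cast hN'
  linarith

theorem theorem3 :
    ∃ H : Set (ℕ → Bool),
      (∀ h ∈ H, Computable h) ∧
      ComputablyUniversallyOnlineLearnable H ∧
      ¬ ComputablyAgnosticallyLearnable H ∧
      ¬ RER H ∧
      H = evilClass ∧
      classClosure H = H ∪ {fun _ => false} :=
  ⟨evilClass, fun _ => computable_of_mem_evilClass,
    ⟨evilLearner, partrec_evilLearner, evilLearner_learns⟩,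
    not_agnosticallyLearnable_evilClass, not_RER_evilClass, rfl, classClosure_evilClass⟩
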